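/- A 3-colored partition of an integer $n\ge 0$ is a finite multiset of positive integers with sum $n$, each part carrying one of the colors black, red, green. For a 3-colored partition $\lambda$ let $\ell_r$ and $\ell_g$ be the numbers of its red and of its green parts, let $\lambda_g$ be the ordinary partition formed by its green parts, let $\#\{1_g\}$ be the number of green parts equal to $1$, let $k$ be its smallest black part (if there is a black part), and let $i_k$ be its $k$-th smallest red part, counted with multiplicity (if $\ell_r\ge k$). For an integer $r\ge 2$, let $\mathcal F_r$ be the set of 3-colored partitions $\lambda$ such that the green subpartition $\lambda_g=(\lambda_1\ge\dots\ge\lambda_s)$ satisfies $\lambda_j-\lambda_{j+r-1}\ge 2$ for $1\le j\le s-r+1$ and has at most $r-1$ parts equal to $1$, and such that one of the following holds: 1. $\lambda$ is empty, or has only one color, or has exactly two colors, one of which is green; 2. $\lambda$ has exactly the two colors black and red, and either $\ell_r\le k-1$, or $\ell_r\ge k$ and $k+i_k\ge r$; 3. $\lambda$ has all three colors, and either $\ell_r\le k-1$, or $\ell_r\ge k$, $k+i_k\ge r$ and $\ell_g-\#\{1_g\}<k+i_k-r+1$. Let $F_r(n)$ be the number of 3-colored partitions of $n$ belonging to $\mathcal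 F_r$. Theorem. For every integer $n\ge 0$, $F_2(n)=F_3(n)=F_4(n)=\cdots$. Moreover, this common value equals the number of partitions of $n$ in which the part $1$ may appear in 3 colors while every other part may appear in 2 colors. Finally, for every $r\ge 2$, $$\sum_{n\ge 0}F_r(n)q^n=\frac{\mathbf H^2}{1-q},\qquad \mathbf H=\sum_{n\ge 0}p(n)q^n,$$ where $p(n)$ is the number of partitions of $n$. -/

import Mathlib

/-- The three colors in which a part may appear. -/
inductive PartColor where
  | black
  | red
  | green
  deriving DecidableEq

instance : Fintype PartColor where
  elems := {.black, .red, .green}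
  complete := by intro x; cases x <;> decide

/-- A 3-colored partition of `n`: a finite multiset of colored positive integers
`(size, color)` whose sizes add up to `n`. -/
@[ext]
structure ColoredPartition (n : ℕ) where
  parts : Multiset (ℕ × PartColor)
  parts_pos : ∀ p ∈ parts, 0 < p.1
  parts_sum : (parts.map Prod.fst).sum = n

namespace ColoredPartition

/-- The subpartition of `l` formed by (the sizes of) the parts of color `c`. -/
def sub {n : ℕ} (l : ColoredPartition n) (c : PartColor) : Multiset ℕ :=
  (l.parts.filter fun p => p.2 = c).map Prod.fst

/-- The set of colors that occur in `l`. -/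
def colors {n : ℕ} (l : ColoredPartition n) : Finset PartColor :=
  (l.parts.map Prod.snd).toFinset

/-- The `j`-th smallest element of `s` (for `1 ≤ j ≤ s.card`), counted with multiplicity. -/
def nthSmallest (s : Multiset ℕ) (j : ℕ) : ℕ :=
  (s.sort (· ≤ ·)).getD (j - 1) 0

/-- The conditions defining the set `𝓑_{r,i}` in Gordon's identities: written as a non-increasing
sequence `λ_1 ≥ ⋯ ≥ λ_s`, the partition satisfies `λ_j - λ_{j+r-1} ≥ 2` whenever both parts exist,
and it has at most `i - 1` parts equal to `1`. -/
def IsGordon (r i : ℕ) (s : Multiset ℕ) : Prop :=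
  (∀ j a b : ℕ, (s.sort (· ≥ ·))[j]? = some a → (s.sort (· ≥ ·))[j + (r - 1)]? = some b →
    b + 2 ≤ a) ∧
  s.count 1 ≤ i - 1

/-- The number `ℓ_c` of parts of color `c`. -/
def len {n : ℕ} (l : ColoredPartition n) (c : PartColor) : ℕ := (l.sub c).card

/-- The smallest black part `k` (meaningful when there is a black part). -/
def k {n : ℕ} (l : ColoredPartition n) : ℕ := nthSmallest (l.sub .black) 1

/-- The `k`-th smallest red part `i_k` (meaningful when there is a black part and there are
at least `k` red parts). -/
def ik {n : ℕ} (l : ColoredPartition n) : ℕ := nthSmallest (l.sub .red) l.k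

/-- Membership of a 3-colored partition in the class `𝓕_r`. -/
def InF {n : ℕ} (r : ℕ) (l : ColoredPartition n) : Prop :=
  IsGordon r r (l.sub .green) ∧
  ( -- empty, or one color, or exactly two colors one of which is green
    (l.parts = 0 ∨ l.colors.card = 1 ∨ (l.colors.card = 2 ∧ .green ∈ l.colors)) ∨
    -- exactly the two colors black and red
    (l.colors = {.black, .red} ∧
      (l.len .red < l.k ∨ (l.k ≤ l.len .red ∧ r ≤ l.k + l.ik))) ∨
    -- all three colors
    (l.colors = {.black, .red, .green} ∧
      (l.len .red < l.k ∨
        (l.k ≤ l.len .red ∧ r ≤ l.k + l.ik ∧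
          (l.len .green : ℤ) - ((l.sub .green).count 1 : ℤ) < (l.k : ℤ) + l.ik - r + 1))))

/-- There are only finitely many 3-colored partitions of `n`. -/
instance instFinite (n : ℕ) : Finite (ColoredPartition n) := by
  let t : Multiset (ℕ × PartColor) :=
    n • (Finset.range (n + 1) ×ˢ (Finset.univ : Finset PartColor)).val
  have hle : ∀ l : ColoredPartition n, l.parts ≤ t := by
    intro l
    rw [Multiset.le_iff_count]
    intro p
    by_cases hp : p ∈ l.parts
    · have h1 : p.1 ≤ n := by
        rw [← l.parts_sum]
        exact Multiset.le_sum_of_mem (Multiset.mem_map_of_mem Prod.fst hp)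
      have h2 : l.parts.card ≤ n := by
        have := Multiset.card_nsmul_le_sum (s := l.parts.map Prod.fst) (a := 1) (by
          intro x hx
          obtain ⟨q, hq, rfl⟩ := Multiset.mem_map.1 hx
          exact l.parts_pos q hq)
        simpa [l.parts_sum] using this
      have h3 : p ∈ (Finset.range (n + 1) ×ˢ (Finset.univ : Finset PartColor)) := by
        simp; omega
      have h4 : t.count p = n := by
        rw [Multiset.count_nsmul, Multiset.count_eq_one_of_mem (Finset.nodup _) h3, mul_one]
      rw [h4]
      exact (Multiset.count_le_card _ _).trans h2
    · rw [Multiset.count_eq_zero_of_notMem hp]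
      exact Nat.zero_le _
  exact Finite.of_injective
    (fun l => (⟨l.parts, by simpa using hle l⟩ : {s // s ∈ t.powerset.toFinset}))
    (fun a b h => ColoredPartition.ext (congrArg Subtype.val h))

/-- `F_r(n)`: the number of 3-colored partitions of `n` that belong to `𝓕_r`. -/
noncomputable def F (r n : ℕ) : ℕ := {l : ColoredPartition n | InF r l}.ncard

/-- The number of partitions of `n` in which the part `1` may appear in all three colors, and every
other part only in the two colors black and red. -/
noncomputable def numOneThreeRestTwo (n : ℕ) : ℕ :=
  {l : ColoredPartition n | ∀ p ∈ l.parts, p.1 ≠ 1 → p.2 = .black ∨ p.2 = .red}.ncard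

/-- `H = ∑ p(n) q^n`, the generating series of all partitions. -/
noncomputable def H : PowerSeries ℚ :=
  PowerSeries.mk fun n => (Fintype.card (Nat.Partition n) : ℚ)

end ColoredPartition

/-! Write (q)_n = (1-q)⋯(1-q^n). A colored partition is a triple (b, d, g) of black, red and green
partitions; let m be the number of parts of g other than 1. The cases defining 𝓕_r merge into one
condition (`inF_iff`): g is a Gordon partition and, if b has least part k, fewer than k parts x of d
satisfy x + k < r + m. Given g, the condition on (b, d) thus depends on m alone.

For a threshold s ≥ 2 such pairs (b, d) have series H² (q)_{s-1} / (1-q) (`gf_goodPairs`). This goes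
by induction on s: the pairs lost from s to s + 1, sorted by k, have series that differ only by
powers of q, so their sum is geometric.

It remains to show that the sum of q^|g| (q)_{r-1+m} over Gordon partitions g is 1
(`sum_gordon_big`). Deleting the ones and lowering the other parts by 1 gives a recursion for a
refined sum with parameters i, N, e (`weightedGordon_succ`). An explicit alternating series obeys
the same recursion (`expansion_succ`), with the same values at i = 0 and for large e. Hence the two
agree (`weightedGordon_expansion`), and the combination needed telescopes to 1 (`sum_expansion`).
Infinite sums are handled as congruences modulo powers of q. -/

namespace PartitionSeries

/-- The generating series of the elements of `S`, weighted by `w`. -/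
noncomputable def gf {α : Type*} (w : α → ℕ) (S : Set α) : PowerSeries ℚ :=
  PowerSeries.mk fun n => (({x | x ∈ S ∧ w x = n}).ncard : ℚ)

/-- Every weight is attained finitely often on `S`. -/
def FinFib {α : Type*} (w : α → ℕ) (S : Set α) : Prop := ∀ n, {x | x ∈ S ∧ w x = n}.Finite

/-! ### Generating series of weighted sets -/

section gf

variable {α β : Type*} {w : α → ℕ} {v : β → ℕ} {S S' : Set α} {T : Set β}

theorem FinFib.mono (h : FinFib w S) (hS : S' ⊆ S) : FinFib w S' := fun n =>
  (h n).subset fun _ hx => ⟨hS hx.1, hx.2⟩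

theorem FinFib.prod (h : FinFib w S) (h' : FinFib v T) :
    FinFib (fun x : α × β => w x.1 + v x.2) (S ×ˢ T) := by
  intro n
  refine Set.Finite.subset (Set.Finite.prod
    ((Finset.range (n + 1)).finite_toSet.biUnion fun i _ => h i)
    ((Finset.range (n + 1)).finite_toSet.biUnion fun i _ => h' i)) ?_
  rintro ⟨x, y⟩ ⟨⟨hx, hy⟩, hn⟩
  simp only [Set.mem_prod, Set.mem_iUnion, Finset.coe_range, Set.mem_Iio, Set.mem_ofPred_eq] at *
  exact ⟨⟨w x, by omega, hx, rfl⟩, ⟨v y, by omega, hy, rfl⟩⟩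

theorem coeff_gf (n : ℕ) :
    PowerSeries.coeff n (gf w S) = (({x | x ∈ S ∧ w x = n}).ncard : ℚ) := by
  simp [gf]

theorem ncard_fiberwise {ι : Type*} [DecidableEq ι] {A : Set α} (hA : A.Finite) (st : α → ι)
    (I : Finset ι) (hI : ∀ x ∈ A, st x ∈ I) :
    A.ncard = ∑ i ∈ I, {x | x ∈ A ∧ st x = i}.ncard := by
  classical
  rw [Set.ncard_eq_toFinset_card A hA,
    Finset.card_eq_sum_card_fiberwise (f := st) (t := I) (fun x hx => hI x (by simpa using hx))]
  refine Finset.sum_congr rfl fun i _ => ?_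
  rw [← Set.ncard_coe_finset]
  congr 1
  ext x
  simp

theorem gf_fiberwise {ι : Type*} [DecidableEq ι] (h : FinFib w S) (st : α → ι)
    (I : Finset ι) (hI : ∀ x ∈ S, st x ∈ I) :
    gf w S = ∑ i ∈ I, gf w {x | x ∈ S ∧ st x = i} := by
  ext n
  rw [map_sum, coeff_gf, ncard_fiberwise (h n) st I fun x hx => hI x hx.1, Nat.cast_sum]
  refine Finset.sum_congr rfl fun i _ => ?_
  rw [coeff_gf]
  congr 2
  ext x
  simp only [Set.mem_ofPred_eq]
  tauto

/-- Up to a given order, only finitely many values of a statistic bounded by the weight matter. -/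
theorem gf_trunc (h : FinFib w S) (st : α → ℕ) (hst : ∀ x ∈ S, st x ≤ w x) (D : ℕ) :
    PowerSeries.X ^ D ∣
      gf w S - ∑ m ∈ Finset.range D, gf w {x | x ∈ S ∧ st x = m} := by
  rw [PowerSeries.X_pow_dvd_iff]
  intro n hn
  rw [map_sub, map_sum, coeff_gf, ncard_fiberwise (h n) st (Finset.range D) fun x hx => ?_,
    Nat.cast_sum, sub_eq_zero]
  · refine Finset.sum_congr rfl fun i _ => ?_
    rw [coeff_gf]
    congr 2
    ext x
    simp only [Set.mem_ofPred_eq]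
    tauto
  · have := hst x hx.1
    have := hx.2
    simp only [Finset.mem_range]
    omega

theorem gf_split (h : FinFib w S) (p : α → Prop) :
    gf w S = gf w {x | x ∈ S ∧ p x} + gf w {x | x ∈ S ∧ ¬ p x} := by
  classical
  rw [gf_fiberwise h (fun x => decide (p x)) Finset.univ (fun _ _ => Finset.mem_univ _)]
  simp

/-- Transport of generating series along a bijection that shifts the weight. -/
theorem gf_image (f : β → α) (c : ℕ) (hf : Set.InjOn f T) (hw : ∀ x ∈ T, w (f x) = v x + c)
    (hS : f '' T = S) : gf w S = PowerSeries.X ^ c * gf v T := by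
  subst hS
  ext n
  rw [PowerSeries.coeff_X_pow_mul', coeff_gf]
  split_ifs with hc
  · rw [coeff_gf, ← (hf.mono fun x hx => hx.1 : Set.InjOn f {x | x ∈ T ∧ v x = n - c}).ncard_image]
    congr 2
    ext y
    constructor
    · rintro ⟨⟨x, hx, rfl⟩, hn⟩
      rw [hw x hx] at hn
      exact ⟨x, ⟨hx, by omega⟩, rfl⟩
    · rintro ⟨x, ⟨hx, hn⟩, rfl⟩
      refine ⟨⟨x, hx, rfl⟩, ?_⟩
      rw [hw x hx]
      omega
  · have : {x | x ∈ f '' T ∧ w x = n} = ∅ := by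
      rw [Set.eq_empty_iff_forall_notMem]
      rintro _ ⟨⟨x, hx, rfl⟩, hn⟩
      rw [hw x hx] at hn
      omega
    rw [this]
    simp

theorem gf_prod (h : FinFib w S) (h' : FinFib v T) :
    gf (fun x : α × β => w x.1 + v x.2) (S ×ˢ T) = gf w S * gf v T := by
  ext n
  rw [PowerSeries.coeff_mul, coeff_gf, ncard_fiberwise (h.prod h' n) (fun x => (w x.1, v x.2))
    (Finset.HasAntidiagonal.antidiagonal n) (fun x hx => by simpa using hx.2), Nat.cast_sum]
  refine Finset.sum_congr rfl fun p hp => ?_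
  rw [coeff_gf, coeff_gf, ← Nat.cast_mul, ← Set.ncard_prod]
  congr 2
  ext ⟨x, y⟩
  have := Finset.HasAntidiagonal.mem_antidiagonal.1 hp
  simp only [Set.mem_ofPred_eq, Set.mem_prod, Prod.ext_iff]
  constructor
  · tauto
  · rintro ⟨⟨h1, h2⟩, h3, h4⟩
    exact ⟨⟨⟨h1, h3⟩, by omega⟩, h2, h4⟩

theorem gf_empty : gf w (∅ : Set α) = 0 := by
  ext n
  simp [coeff_gf]

theorem gf_singleton (a : α) : gf w {a} = PowerSeries.X ^ w a := by
  ext n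
  rw [coeff_gf, PowerSeries.coeff_X_pow]
  split_ifs with hn
  · have : {x | x ∈ ({a} : Set α) ∧ w x = n} = {a} := by
      ext x
      simp only [Set.mem_singleton_iff, Set.mem_ofPred_eq]
      constructor
      · tauto
      · rintro rfl
        exact ⟨rfl, hn.symm⟩
    rw [this]
    simp
  · have : {x | x ∈ ({a} : Set α) ∧ w x = n} = ∅ := by
      rw [Set.eq_empty_iff_forall_notMem]
      rintro x ⟨rfl, hx⟩
      exact hn hx.symm
    rw [this]
    simp

end gf

/-- The partitions, as multisets of positive integers. -/
def partitions : Set (Multiset ℕ) := {s | 0 ∉ s}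

theorem fiber_partitions (n : ℕ) : {s | s ∈ partitions ∧ s.sum = n} =
    Set.range (Nat.Partition.parts : n.Partition → Multiset ℕ) := by
  ext s
  constructor
  · rintro ⟨h, hn⟩
    exact ⟨⟨s, fun {i} hi => Nat.pos_of_ne_zero fun h0 => h (h0 ▸ hi), hn⟩, rfl⟩
  · rintro ⟨p, rfl⟩
    exact ⟨fun h => absurd (p.parts_pos h) (lt_irrefl _), p.parts_sum⟩

theorem finFib_partitions : FinFib Multiset.sum partitions := fun n => by
  rw [fiber_partitions]
  exact Set.finite_range _

theorem gf_partitions : gf Multiset.sum partitions = ColoredPartition.H := by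
  ext n
  rw [coeff_gf, fiber_partitions, ColoredPartition.H, PowerSeries.coeff_mk, ← Set.image_univ,
    Set.ncard_image_of_injective _ fun p p' h => Nat.Partition.ext h, Set.ncard_univ,
    Nat.card_eq_fintype_card]

theorem card_le_sum {s : Multiset ℕ} (hs : s ∈ partitions) : s.card ≤ s.sum := by
  have := Multiset.card_nsmul_le_sum (s := s) (a := 1)
    (fun x hx => Nat.pos_of_ne_zero fun h0 => hs (h0 ▸ hx))
  simpa using this

end PartitionSeries

/-! ### Pairs of black and red partitions -/

namespace PartitionSeries

open PowerSeries

/-- The product `(1 - q^(M+1)) ⋯ (1 - q^(M+c))`. -/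
noncomputable def poch (M c : ℕ) : PowerSeries ℚ := ∏ j ∈ Finset.range c, (1 - X ^ (M + 1 + j))

@[simp] theorem poch_zero (M : ℕ) : poch M 0 = 1 := by simp [poch]

theorem poch_succ (M c : ℕ) : poch M (c + 1) = poch M c * (1 - X ^ (M + c + 1)) := by
  rw [poch, Finset.prod_range_succ, ← poch, show M + 1 + c = M + c + 1 by ring]

theorem poch_succ' (M c : ℕ) : poch M (c + 1) = (1 - X ^ (M + 1)) * poch (M + 1) c := by
  rw [poch, Finset.prod_range_succ', mul_comm, poch]
  congr 1
  exact Finset.prod_congr rfl fun j _ => by ring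

theorem poch_add (M c d : ℕ) : poch M (c + d) = poch M c * poch (M + c) d := by
  induction d with
  | zero => simp
  | succ d ih => rw [← add_assoc, poch_succ, ih, poch_succ, mul_assoc, add_assoc M c d]

/-- The partitions with fewer than `k` parts of size at most `a`. -/
def fewSmall (k a : ℕ) : Set (Multiset ℕ) := {s | s ∈ partitions ∧ s.countP (· ≤ a) < k}

theorem finFib_fewSmall (k a : ℕ) : FinFib Multiset.sum (fewSmall k a) :=
  finFib_partitions.mono fun _ h => h.1

theorem countP_le_mono (s : Multiset ℕ) {a b : ℕ} (h : a ≤ b) :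
    s.countP (· ≤ a) ≤ s.countP (· ≤ b) := by
  rw [Multiset.countP_eq_card_filter, Multiset.countP_eq_card_filter]
  exact Multiset.card_le_card (Multiset.monotone_filter_right s fun x hx => le_trans hx h)

theorem countP_le_succ (s : Multiset ℕ) (a : ℕ) :
    s.countP (· ≤ a + 1) = s.countP (· ≤ a) + s.count (a + 1) := by
  induction s using Multiset.induction_on with
  | empty => simp
  | cons x s ih =>
    rw [Multiset.countP_cons, Multiset.countP_cons, Multiset.count_cons, ih]
    split_ifs <;> omega

theorem gf_fewSmall_sub (k a : ℕ) :
    gf Multiset.sum (fewSmall k a) - gf Multiset.sum (fewSmall k (a + 1)) =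
      gf Multiset.sum {s | s ∈ fewSmall k a ∧ ¬ s.countP (· ≤ a + 1) < k} := by
  rw [gf_split (finFib_fewSmall k a) fun s => s.countP (· ≤ a + 1) < k, sub_eq_iff_eq_add, add_comm]
  congr 2
  ext s
  have := countP_le_mono s (Nat.le_succ a)
  simp only [fewSmall, Set.mem_ofPred_eq, Nat.succ_eq_add_one] at *
  constructor
  · rintro ⟨⟨h, -⟩, h'⟩
    exact ⟨h, h'⟩
  · rintro ⟨h, h'⟩
    exact ⟨⟨h, by omega⟩, h'⟩

theorem gf_fewSmall_sub' (k a : ℕ) :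
    gf Multiset.sum (fewSmall (k + 1) a) - gf Multiset.sum (fewSmall k (a + 1)) =
      gf Multiset.sum {s | s ∈ fewSmall (k + 1) a ∧ ¬ s.countP (· ≤ a + 1) < k} := by
  rw [gf_split (finFib_fewSmall (k + 1) a) fun s => s.countP (· ≤ a + 1) < k, sub_eq_iff_eq_add,
    add_comm]
  congr 2
  ext s
  have := countP_le_mono s (Nat.le_succ a)
  simp only [fewSmall, Set.mem_ofPred_eq, Nat.succ_eq_add_one] at *
  constructor
  · rintro ⟨⟨h, -⟩, h'⟩
    exact ⟨h, h'⟩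
  · rintro ⟨h, h'⟩
    exact ⟨⟨h, by omega⟩, h'⟩

/-- At most `k` parts up to `a` but more than `k` up to `a + 1` force a part `a + 1`; deleting one
copy of it is the bijection. -/
theorem gf_fewSmall_remove (k a : ℕ) :
    gf Multiset.sum {s | s ∈ fewSmall (k + 1) a ∧ ¬ s.countP (· ≤ a + 1) < k + 1} =
      X ^ (a + 1) * gf Multiset.sum {s | s ∈ fewSmall (k + 1) a ∧ ¬ s.countP (· ≤ a + 1) < k} := by
  refine gf_image (fun s => (a + 1) ::ₘ s) (a + 1) (fun s _ t _ h => by simpa using h)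
    (fun s _ => by rw [Multiset.sum_cons, add_comm]) ?_
  ext s
  simp only [Set.mem_image, fewSmall, Set.mem_ofPred_eq, partitions]
  constructor
  · rintro ⟨t, ⟨⟨h0, h1⟩, h2⟩, rfl⟩
    refine ⟨⟨?_, ?_⟩, ?_⟩
    · simpa using h0
    · rwa [Multiset.countP_cons_of_neg _ (by omega)]
    · rw [Multiset.countP_cons_of_pos _ (by simp)]
      omega
  · rintro ⟨⟨h0, h1⟩, h2⟩
    have h3 : a + 1 ∈ s := by
      rw [countP_le_succ] at h2
      rw [← Multiset.count_pos]
      omega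
    obtain ⟨t, rfl⟩ := Multiset.exists_cons_of_mem h3
    rw [Multiset.countP_cons_of_neg _ (by omega)] at h1
    rw [Multiset.countP_cons_of_pos _ (by simp)] at h2
    exact ⟨t, ⟨⟨fun h => h0 (Multiset.mem_cons_of_mem h), h1⟩, by omega⟩, rfl⟩

theorem gf_fewSmall_rec (k a : ℕ) :
    gf Multiset.sum (fewSmall (k + 1) (a + 1)) =
      (1 - X ^ (a + 1)) * gf Multiset.sum (fewSmall (k + 1) a) +
        X ^ (a + 1) * gf Multiset.sum (fewSmall k (a + 1)) := by
  have h1 := gf_fewSmall_sub (k + 1) a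
  have h2 := gf_fewSmall_sub' k a
  rw [gf_fewSmall_remove, ← h2] at h1
  linear_combination -h1

/-- The recursion `gf_fewSmall_rec` determines the series from `a = 0`, where nothing is excluded,
and from bound `0`, where no partition remains; the product obeys it too. -/
theorem gf_fewSmall (k a : ℕ) :
    gf Multiset.sum (fewSmall (k + 1) a) = ColoredPartition.H * poch k a := by
  induction a generalizing k with
  | zero =>
    rw [poch_zero, mul_one, ← gf_partitions]
    congr 1
    ext s
    simp only [fewSmall, Set.mem_ofPred_eq, and_iff_left_iff_imp]
    intro hs
    have : s.countP (· ≤ 0) = 0 := by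
      rw [Multiset.countP_eq_zero]
      intro x hx h
      exact hs ((Nat.le_zero.1 h) ▸ hx)
    omega
  | succ a ih =>
    induction k with
    | zero =>
      rw [gf_fewSmall_rec, ih]
      have : fewSmall 0 (a + 1) = ∅ := by
        ext s
        simp [fewSmall]
      rw [this, gf_empty, poch_succ, zero_add]
      ring
    | succ k ihk =>
      rw [gf_fewSmall_rec, ih, ihk, poch_succ' k, poch_succ (k + 1) a]
      ring

/-- The partitions with smallest part `k`. -/
def leastPart (k : ℕ) : Set (Multiset ℕ) := {s | s ∈ partitions ∧ k ∈ s ∧ ∀ x ∈ s, k ≤ x}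

theorem gf_leastPart (k : ℕ) :
    gf Multiset.sum (leastPart (k + 1)) = X ^ (k + 1) * (ColoredPartition.H * poch 0 k) := by
  rw [← gf_fewSmall]
  refine gf_image (fun s => (k + 1) ::ₘ s) (k + 1) (fun s _ t _ h => by simpa using h)
    (fun s _ => by rw [Multiset.sum_cons, add_comm]) ?_
  ext s
  simp only [Set.mem_image, fewSmall, leastPart, Set.mem_ofPred_eq, partitions, zero_add,
    Nat.lt_one_iff, Multiset.countP_eq_zero]
  constructor
  · rintro ⟨t, ⟨h0, h1⟩, rfl⟩
    refine ⟨by simpa using h0, by simp, ?_⟩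
    intro x hx
    rcases Multiset.mem_cons.1 hx with rfl | hx
    · exact le_rfl
    · have := h1 x hx
      omega
  · rintro ⟨h0, h1, h2⟩
    obtain ⟨t, rfl⟩ := Multiset.exists_cons_of_mem h1
    refine ⟨t, ⟨fun h => h0 (Multiset.mem_cons_of_mem h), fun x hx => ?_⟩, rfl⟩
    have := h2 x (Multiset.mem_cons_of_mem hx)
    omega

/-- If `k` is the smallest element of `b`, then fewer than `k` elements `x` of `d` have
`x + k < s`. -/
def Good (s : ℕ) (b d : Multiset ℕ) : Prop :=
  ∀ k ∈ b, (∀ x ∈ b, k ≤ x) → d.countP (fun x => x + k < s) < k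

def goodPairs (s : ℕ) : Set (Multiset ℕ × Multiset ℕ) :=
  {x | x ∈ partitions ×ˢ partitions ∧ Good s x.1 x.2}

/-- The total size of a pair of partitions. -/
def pairSum (x : Multiset ℕ × Multiset ℕ) : ℕ := x.1.sum + x.2.sum

theorem finFib_goodPairs (s : ℕ) : FinFib pairSum (goodPairs s) :=
  (finFib_partitions.prod finFib_partitions).mono fun _ h => h.1

theorem Good.of_succ {s : ℕ} {b d : Multiset ℕ} (h : Good (s + 1) b d) : Good s b d := by
  intro k hk hk'
  refine lt_of_le_of_lt ?_ (h k hk hk')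
  rw [Multiset.countP_eq_card_filter, Multiset.countP_eq_card_filter]
  exact Multiset.card_le_card (Multiset.monotone_filter_right d fun x hx => Nat.lt_succ_of_lt hx)

theorem gf_goodPairs_two : gf pairSum (goodPairs 2) = ColoredPartition.H ^ 2 := by
  rw [pow_two, ← gf_partitions, ← gf_prod finFib_partitions finFib_partitions]
  refine congrArg (gf pairSum) ?_
  ext ⟨b, d⟩
  simp only [goodPairs, Set.mem_ofPred_eq, and_iff_left_iff_imp]
  rintro ⟨hb, hd⟩ k hk -
  have hk0 : k ≠ 0 := fun h => hb (h ▸ hk)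
  have : d.countP (fun x => x + k < 2) = 0 := by
    rw [Multiset.countP_eq_zero]
    intro x hx h
    have : x = 0 := by omega
    exact hd (this ▸ hx)
  omega

/-- With least black part `j + 1` fixed, black and red conditions decouple. Their factors `poch 0 j`
and `poch j a` combine to `poch 0 (j + a)`, which depends only on the threshold. -/
theorem gf_goodPairs_fiber (j a : ℕ) :
    gf pairSum {x | (x ∈ goodPairs (j + a + 2) ∧ ¬ Good (j + a + 3) x.1 x.2) ∧
      sInf {y | y ∈ x.1} = j + 1} =
    X ^ (2 * j + a + 2) * ColoredPartition.H ^ 2 * poch 0 (j + a) := by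
  have hset : {x | (x ∈ goodPairs (j + a + 2) ∧ ¬ Good (j + a + 3) x.1 x.2) ∧
      sInf {y | y ∈ x.1} = j + 1} =
      leastPart (j + 1) ×ˢ
        {s | s ∈ fewSmall (j + 1) a ∧ ¬ s.countP (· ≤ a + 1) < j + 1} := by
    ext ⟨b, d⟩
    simp only [goodPairs, Set.mem_ofPred_eq, Set.mem_prod, leastPart, fewSmall]
    have e1 : d.countP (fun x => x + (j + 1) < j + a + 2) = d.countP (· ≤ a) :=
      Multiset.countP_congr rfl fun x _ => by simp only [eq_iff_iff]; omega
    have e2 : d.countP (fun x => x + (j + 1) < j + a + 3) = d.countP (· ≤ a + 1) :=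
      Multiset.countP_congr rfl fun x _ => by simp only [eq_iff_iff]; omega
    constructor
    · rintro ⟨⟨⟨⟨hb, hd⟩, hg⟩, hn⟩, hi⟩
      have hne : {y | y ∈ b}.Nonempty := by
        by_contra h
        rw [Set.not_nonempty_iff_eq_empty] at h
        rw [h] at hi
        simp at hi
      have h1 : j + 1 ∈ b := hi ▸ Nat.sInf_mem hne
      have h2 : ∀ x ∈ b, j + 1 ≤ x := fun x hx => hi ▸ Nat.sInf_le hx
      refine ⟨⟨hb, h1, h2⟩, ⟨hd, e1 ▸ hg _ h1 h2⟩, fun h => hn ?_⟩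
      intro k hk hk'
      obtain rfl : k = j + 1 := le_antisymm (hk' _ h1) (h2 _ hk)
      rwa [e2]
    · rintro ⟨⟨hb, h1, h2⟩, ⟨hd, h3⟩, h4⟩
      refine ⟨⟨⟨⟨hb, hd⟩, ?_⟩, ?_⟩, ?_⟩
      · intro k hk hk'
        obtain rfl : k = j + 1 := le_antisymm (hk' _ h1) (h2 _ hk)
        rwa [e1]
      · intro h
        exact h4 (e2 ▸ h _ h1 h2)
      · exact le_antisymm (Nat.sInf_le h1) (le_csInf ⟨_, h1⟩ fun x hx => h2 x hx)
  rw [hset]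
  change gf (fun x : Multiset ℕ × Multiset ℕ => x.1.sum + x.2.sum) _ = _
  rw [gf_prod (finFib_partitions.mono fun _ h => h.1)
    (finFib_partitions.mono fun _ h => h.1.1), ← gf_fewSmall_sub, gf_leastPart, gf_fewSmall,
    gf_fewSmall, poch_succ, poch_add, zero_add]
  ring

theorem gf_goodPairs_succ (t : ℕ) :
    gf pairSum (goodPairs (t + 2)) = gf pairSum (goodPairs (t + 3)) +
      ∑ j ∈ Finset.range (t + 1), X ^ (t + j + 2) * ColoredPartition.H ^ 2 * poch 0 t := by
  rw [gf_split (finFib_goodPairs (t + 2)) fun x => Good (t + 3) x.1 x.2]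
  congr 1
  · congr 1
    ext x
    simp only [goodPairs, Set.mem_ofPred_eq]
    exact ⟨fun h => ⟨h.1.1, h.2⟩, fun h => ⟨⟨h.1, h.2.of_succ⟩, h.2⟩⟩
  · rw [gf_fiberwise ((finFib_goodPairs (t + 2)).mono fun _ h => h.1)
      (fun x => sInf {y | y ∈ x.1} - 1) (Finset.range (t + 1))]
    · refine Finset.sum_congr rfl fun j hj => ?_
      obtain ⟨a, rfl⟩ : ∃ a, t = j + a := ⟨t - j, by have := Finset.mem_range.1 hj; omega⟩
      rw [show j + a + j + 2 = 2 * j + a + 2 by ring, ← gf_goodPairs_fiber]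
      congr 1
      ext ⟨b, d⟩
      simp only [Set.mem_ofPred_eq]
      refine and_congr_right fun h => ?_
      have hb := h.1.1.1
      -- For empty `b` the infimum is 0 by default and truncated subtraction would put it in the
      -- fiber of least part 1; but then `Good` holds vacuously, contrary to `h`.
      have : sInf {y | y ∈ b} ≠ 0 := by
        intro h0
        rw [Nat.sInf_eq_zero] at h0
        rcases h0 with h0 | h0
        · exact hb h0
        · refine h.2 fun k hk => ?_
          have : k ∈ {y | y ∈ b} := hk
          rw [h0] at this
          exact this.elim
      omega
    · rintro ⟨b, d⟩ ⟨⟨⟨hb, hd⟩, hg⟩, hn⟩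
      simp only [Good, not_forall] at hn
      obtain ⟨k, hk, hk', hc⟩ := hn
      have hk0 : k ≠ 0 := fun h => hb (h ▸ hk)
      -- A failure at `k` yields a red part `x ≥ 1` with `x + k < t + 3`, hence `k - 1 ≤ t`.
      have : 0 < d.countP (fun x => x + k < t + 3) := by omega
      obtain ⟨x, hx, hxk⟩ := Multiset.countP_pos.1 this
      have hx0 : x ≠ 0 := fun h => hd (h ▸ hx)
      have : sInf {y | y ∈ b} ≤ k := Nat.sInf_le hk
      simp only [Finset.mem_range]
      omega

/-- The generating series of the pairs satisfying `Good`. -/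
theorem gf_goodPairs (t : ℕ) :
    (1 - X) * gf pairSum (goodPairs (t + 2)) = ColoredPartition.H ^ 2 * poch 0 (t + 1) := by
  induction t with
  | zero =>
    rw [zero_add, gf_goodPairs_two, poch_succ]
    simp
    ring
  | succ t ih =>
    rw [gf_goodPairs_succ, ← Finset.sum_mul, ← Finset.sum_mul] at ih
    have h : (1 - X : PowerSeries ℚ) * ∑ j ∈ Finset.range (t + 1), X ^ (t + j + 2) =
        X ^ (t + 2) * (1 - X ^ (t + 1)) := by
      rw [← mul_neg_geom_sum X (t + 1), Finset.mul_sum, Finset.mul_sum, Finset.mul_sum]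
      exact Finset.sum_congr rfl fun j _ => by ring
    rw [poch_succ _ (t + 1), show t + 1 + 2 = t + 3 by ring]
    rw [poch_succ] at ih ⊢
    simp only [zero_add] at *
    linear_combination ih - ColoredPartition.H ^ 2 * poch 0 t * h

end PartitionSeries

/-! ### Gordon partitions by number of parts -/

namespace PartitionSeries

open PowerSeries

/-- The entries satisfying `p` form an initial segment of `L`. -/
theorem getElem?_countP {α : Type*} {p : α → Prop} [DecidablePred p] {L : List α}
    (hL : L.Pairwise fun x y => p y → p x) {j : ℕ} {a : α} (ha : L[j]? = some a) :
    p a ↔ j < L.countP p := by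
  induction L generalizing j with
  | nil => simp at ha
  | cons x L ih =>
    rw [List.pairwise_cons] at hL
    have hzero : ¬ p x → L.countP p = 0 := fun h => by
      rw [List.countP_eq_zero]
      intro y hy hpy
      exact h (hL.1 y hy (by simpa using hpy))
    cases j with
    | zero =>
      obtain rfl : x = a := by simpa using ha
      by_cases hx : p x
      · simp [hx]
      · simp [hx, hzero hx]
    | succ j =>
      have ha' : L[j]? = some a := by simpa using ha
      have := ih hL.2 ha'
      by_cases hx : p x
      · simp [hx, this]
      · have h0 := hzero hx
        simp only [h0, not_lt_zero, iff_false] at this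
        simp [hx, h0, this]

theorem countP_ge_succ (s : Multiset ℕ) (a : ℕ) :
    s.countP (a ≤ ·) = s.countP (a + 1 ≤ ·) + s.count a := by
  induction s using Multiset.induction_on with
  | empty => simp
  | cons x s ih =>
    rw [Multiset.countP_cons, Multiset.countP_cons, Multiset.count_cons, ih]
    split_ifs <;> omega

/-- Gordon's difference condition in terms of multiplicities. -/
theorem isGordon_iff {r : ℕ} (hr : 2 ≤ r) {s : Multiset ℕ} (hs : s ∈ partitions) :
    ColoredPartition.IsGordon r r s ↔ ∀ v, s.count v + s.count (v + 1) < r := by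
  have hcount : ∀ v, (s.sort (· ≥ ·)).countP (fun x => v ≤ x) = s.countP (v ≤ ·) := fun v => by
    rw [← Multiset.coe_countP, Multiset.sort_eq]
  have key : ∀ {j a v : ℕ}, (s.sort (· ≥ ·))[j]? = some a → (v ≤ a ↔ j < s.countP (v ≤ ·)) := by
    intro j a v ha
    rw [← hcount]
    exact getElem?_countP (p := fun x => v ≤ x)
      ((Multiset.pairwise_sort s (· ≥ ·)).imp fun h h' => le_trans h' h) ha
  have hlen : (s.sort (· ≥ ·)).length = s.card := Multiset.length_sort _
  have hsum : ∀ v, s.countP (v ≤ ·) = s.countP (v + 2 ≤ ·) + (s.count v + s.count (v + 1)) := by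
    intro v
    rw [countP_ge_succ, countP_ge_succ s (v + 1)]
    ring
  constructor
  · rintro ⟨h, h1⟩ v
    by_contra hv
    have hle : s.countP (v ≤ ·) ≤ s.card := Multiset.countP_le_card _ _
    -- The first part below `v + 2` and the part `r - 1` places later then both lie in `{v, v + 1}`,
    -- which violates the difference condition.
    have hj : s.countP (v + 2 ≤ ·) + (r - 1) < s.countP (v ≤ ·) := by
      have := hsum v
      omega
    have ha := List.getElem?_eq_getElem (l := s.sort (· ≥ ·)) (i := s.countP (v + 2 ≤ ·))
      (by omega)
    have hb := List.getElem?_eq_getElem (l := s.sort (· ≥ ·))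
      (i := s.countP (v + 2 ≤ ·) + (r - 1)) (by omega)
    have h2 := h _ _ _ ha hb
    have h3 := (key (v := v + 2) ha).not.2 (lt_irrefl _)
    have h4 := (key (v := v) hb).2 hj
    omega
  · intro h
    refine ⟨fun j a b ha hb => ?_, ?_⟩
    · by_contra hab
      have h3 := (key (v := b + 2) ha).not.1 hab
      have h4 := (key (v := b) hb).1 le_rfl
      have h5 := hsum b
      have := h b
      omega
    -- As 0 is not a part, `v = 0` bounds the number of ones.
    · have h0 := h 0
      rw [Multiset.count_eq_zero_of_notMem hs] at h0
      simp only [zero_add] at h0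
      omega

/-- The partitions whose multiplicities of consecutive sizes add up to less than `r`. -/
def gordon (r : ℕ) : Set (Multiset ℕ) :=
  {s | s ∈ partitions ∧ ∀ v, s.count v + s.count (v + 1) < r}

theorem finFib_gordon (r : ℕ) : FinFib Multiset.sum (gordon r) :=
  finFib_partitions.mono fun _ h => h.1

/-- The generating series of the Gordon partitions with `m` parts, fewer than `i` of them `1`. -/
noncomputable def gordonSeries (r i m : ℕ) : PowerSeries ℚ :=
  gf Multiset.sum {s | s ∈ gordon r ∧ s.count 1 < i ∧ s.card = m}

theorem gordonSeries_zero_left (r m : ℕ) : gordonSeries r 0 m = 0 := by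
  rw [gordonSeries, ← gf_empty (w := Multiset.sum)]
  congr 1
  ext s
  simp

theorem gordonSeries_zero_right {r i : ℕ} (hr : 0 < r) (hi : 0 < i) : gordonSeries r i 0 = 1 := by
  have : {s | s ∈ gordon r ∧ s.count 1 < i ∧ s.card = 0} = {0} := by
    ext s
    simp only [gordon, partitions, Set.mem_ofPred_eq, Multiset.card_eq_zero,
      Set.mem_singleton_iff]
    constructor
    · tauto
    · rintro rfl
      simp [hr, hi]
  rw [gordonSeries, this, gf_singleton]
  simp

theorem X_pow_dvd_gordonSeries (r i m : ℕ) : X ^ m ∣ gordonSeries r i m := by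
  rw [X_pow_dvd_iff]
  intro n hn
  have : {s | s ∈ {s | s ∈ gordon r ∧ s.count 1 < i ∧ s.card = m} ∧ s.sum = n} = ∅ := by
    rw [Set.eq_empty_iff_forall_notMem]
    rintro s ⟨⟨h1, h2, h3⟩, h4⟩
    have := card_le_sum h1.1
    omega
  rw [gordonSeries, coeff_gf, this]
  simp

/-- The added ones enter the Gordon conditions only at sizes 0 and 1: these read `j < r` and `j +
t.count 1 < r`. The others are those of `t`, shifted. -/
theorem gordon_lift {r j m : ℕ} (hj : j < r) {t : Multiset ℕ} (ht : 0 ∉ t) :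
    (t.map Nat.succ + Multiset.replicate j 1 ∈ gordon r ∧
      (t.map Nat.succ + Multiset.replicate j 1).count 1 = j ∧
      (t.map Nat.succ + Multiset.replicate j 1).card = m + j) ↔
    t ∈ gordon r ∧ t.count 1 < r - j ∧ t.card = m := by
  have h0 : t.count 0 = 0 := Multiset.count_eq_zero_of_notMem ht
  have hc : ∀ v, (t.map Nat.succ).count (v + 1) = t.count v := fun v =>
    Multiset.count_map_eq_count' Nat.succ t Nat.succ_injective v
  have c0 : (t.map Nat.succ + Multiset.replicate j 1).count 0 = 0 := by
    simp [Multiset.mem_replicate]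
  have c1 : (t.map Nat.succ + Multiset.replicate j 1).count 1 = j := by
    rw [Multiset.count_add, hc 0, h0, Multiset.count_replicate_self, zero_add]
  have c2 : ∀ v, (t.map Nat.succ + Multiset.replicate j 1).count (v + 2) = t.count (v + 1) := by
    intro v
    rw [Multiset.count_add, hc, Multiset.count_replicate, if_neg (by omega), add_zero]
  have cc : (t.map Nat.succ + Multiset.replicate j 1).card = t.card + j := by simp
  rw [cc, c1]
  simp only [gordon, partitions, Set.mem_ofPred_eq]
  constructor
  · rintro ⟨⟨-, h⟩, -, h3⟩
    have h1 := h 1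
    rw [c1, c2 0] at h1
    refine ⟨⟨ht, fun v => ?_⟩, by simp only [zero_add] at h1; omega, by omega⟩
    cases v with
    | zero => rw [h0]; omega
    | succ v =>
      have := h (v + 2)
      rwa [c2, c2 (v + 1)] at this
  · rintro ⟨⟨-, h⟩, h2, h3⟩
    refine ⟨⟨by rw [← Multiset.count_eq_zero, c0], fun v => ?_⟩, trivial, by omega⟩
    match v with
    | 0 => rw [c0, zero_add, c1]; exact hj
    | 1 => rw [c1, c2 0, zero_add]; omega
    | v + 2 => rw [c2, c2 (v + 1)]; exact h _

theorem gf_gordon_ones {r j : ℕ} (m : ℕ) (hj : j < r) :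
    gf Multiset.sum {s | s ∈ gordon r ∧ s.count 1 = j ∧ s.card = m + j} =
      X ^ (m + j) * gordonSeries r (r - j) m := by
  refine gf_image (fun t => t.map Nat.succ + Multiset.replicate j 1) (m + j) ?_ ?_ ?_
  · intro s _ t _ h
    exact Multiset.map_injective Nat.succ_injective (add_right_cancel h)
  · rintro t ⟨-, -, rfl⟩
    have : (t.map Nat.succ).sum = t.sum + t.card := by
      simp [Nat.succ_eq_add_one, Multiset.sum_map_add]
    rw [Multiset.sum_add, this, Multiset.sum_replicate]
    simp [add_assoc]
  · ext s
    constructor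
    · rintro ⟨t, ht, rfl⟩
      exact (gordon_lift hj ht.1.1).2 ht
    · rintro hs
      have h0 : 0 ∉ (s.filter (¬ · = 1)).map Nat.pred := by
        intro h
        obtain ⟨x, hx, hx0⟩ := Multiset.mem_map.1 h
        rw [Multiset.mem_filter] at hx
        have : x ≠ 0 := fun h => hs.1.1 (h ▸ hx.1)
        rw [Nat.pred_eq_sub_one] at hx0
        omega
      have h1 : ((s.filter (¬ · = 1)).map Nat.pred).map Nat.succ + Multiset.replicate j 1 = s := by
        conv_rhs => rw [← Multiset.filter_add_not (· = 1) s, Multiset.filter_eq', hs.2.1]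
        rw [add_comm, Multiset.map_map]
        congr 1
        conv_rhs => rw [← Multiset.map_id (s.filter (¬ · = 1))]
        refine Multiset.map_congr rfl fun x hx => ?_
        have : x ≠ 0 := fun h => hs.1.1 (h ▸ (Multiset.mem_filter.1 hx).1)
        simp only [Function.comp_apply, id_eq, Nat.succ_eq_add_one, Nat.pred_eq_sub_one]
        omega
      refine ⟨_, (gordon_lift hj h0).1 ?_, h1⟩
      rw [h1]
      exact hs

theorem gordonSeries_succ {r i : ℕ} (m : ℕ) :
    gordonSeries r (i + 1) m = gordonSeries r i m +
      gf Multiset.sum {s | s ∈ gordon r ∧ s.count 1 = i ∧ s.card = m} := by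
  rw [gordonSeries, gf_split ((finFib_gordon r).mono fun _ h => h.1) fun s => s.count 1 < i,
    gordonSeries]
  congr 2 <;> ext s <;> simp only [Set.mem_ofPred_eq] <;> constructor <;> intro h
  · exact ⟨h.1.1, h.2, h.1.2.2⟩
  · exact ⟨⟨h.1, by omega, h.2.2⟩, h.2.1⟩
  · exact ⟨h.1.1, by omega, h.1.2.2⟩
  · exact ⟨⟨h.1, by omega, h.2.2⟩, by omega⟩

theorem gordonSeries_succ_add {r i : ℕ} (m : ℕ) (hi : i < r) :
    gordonSeries r (i + 1) (m + i) = gordonSeries r i (m + i) +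
      X ^ (m + i) * gordonSeries r (r - i) m := by
  rw [gordonSeries_succ, gf_gordon_ones m hi]

theorem gordonSeries_succ_of_lt {r i m : ℕ} (hm : m < i) :
    gordonSeries r (i + 1) m = gordonSeries r i m := by
  have : {s | s ∈ gordon r ∧ s.count 1 = i ∧ s.card = m} = ∅ := by
    rw [Set.eq_empty_iff_forall_notMem]
    rintro s ⟨-, h1, h2⟩
    have := Multiset.count_le_card 1 s
    omega
  rw [gordonSeries_succ, this, gf_empty, add_zero]

/-- The Gordon partitions by their number of parts different from `1`. -/
theorem gf_gordon_big {r : ℕ} (m : ℕ) :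
    gf Multiset.sum {s | s ∈ gordon r ∧ s.card - s.count 1 = m} =
      ∑ j ∈ Finset.range r, X ^ (m + j) * gordonSeries r (r - j) m := by
  rw [gf_fiberwise ((finFib_gordon r).mono fun _ h => h.1) (fun s => s.count 1) (Finset.range r)]
  · refine Finset.sum_congr rfl fun j hj => ?_
    rw [← gf_gordon_ones m (Finset.mem_range.1 hj)]
    congr 1
    ext s
    have := Multiset.count_le_card 1 s
    simp only [Set.mem_ofPred_eq]
    constructor
    · rintro ⟨⟨h1, h2⟩, h3⟩
      exact ⟨h1, h3, by omega⟩
    · rintro ⟨h1, h2, h3⟩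
      exact ⟨⟨h1, by omega⟩, h2⟩
  · rintro s ⟨⟨-, h⟩, -⟩
    have := h 1
    simp only [Finset.mem_range]
    omega

end PartitionSeries

/-! ### Weighted sums over Gordon partitions and their expansion -/

namespace PartitionSeries

open PowerSeries

/-- The inverse of `poch`. -/
noncomputable def ipoch (M c : ℕ) : PowerSeries ℚ := (poch M c)⁻¹

theorem constantCoeff_poch (M c : ℕ) : constantCoeff (poch M c) = 1 := by
  induction c with
  | zero => simp
  | succ c ih => simp [poch_succ, ih]

theorem poch_mul_ipoch (M c : ℕ) : poch M c * ipoch M c = 1 :=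
  PowerSeries.mul_inv_cancel _ (by rw [constantCoeff_poch]; exact one_ne_zero)

theorem ipoch_eq_iff {M c : ℕ} {f : PowerSeries ℚ} : f = ipoch M c ↔ f * poch M c = 1 := by
  constructor
  · rintro rfl
    rw [mul_comm, poch_mul_ipoch]
  · intro h
    linear_combination ipoch M c * h - f * poch_mul_ipoch M c

theorem ipoch_succ (M c : ℕ) : ipoch M (c + 1) * (1 - X ^ (M + c + 1)) = ipoch M c := by
  have h := poch_mul_ipoch M (c + 1)
  rw [poch_succ] at h
  rw [ipoch_eq_iff]
  linear_combination h

theorem ipoch_succ' (M c : ℕ) : ipoch M (c + 1) * (1 - X ^ (M + 1)) = ipoch (M + 1) c := by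
  have h := poch_mul_ipoch M (c + 1)
  rw [poch_succ'] at h
  rw [ipoch_eq_iff]
  linear_combination h

theorem ipoch_telescope (M c : ℕ) :
    X ^ c * ipoch (M + 1) c - ipoch M c = -((1 - X ^ c) * ipoch M (c + 1)) := by
  rw [← ipoch_succ M c, ← ipoch_succ' M c]
  ring

theorem X_pow_dvd_poch_sub_one (e c : ℕ) : X ^ (e + 1) ∣ poch e c - 1 := by
  induction c with
  | zero => simp
  | succ c ih =>
    rw [poch_succ, show poch e c * (1 - X ^ (e + c + 1)) - 1 =
      (poch e c - 1) - X ^ (e + 1) * (poch e c * X ^ c) by ring]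
    exact dvd_sub ih (Dvd.intro _ rfl)

/-- The `n`-th triangular number. -/
def tri (n : ℕ) : ℕ := ∑ k ∈ Finset.range (n + 1), k

theorem tri_zero : tri 0 = 0 := rfl

theorem tri_succ (n : ℕ) : tri (n + 1) = tri n + (n + 1) := Finset.sum_range_succ _ _

/-- The positive half of the terms in the expansion of `weightedGordon`. -/
noncomputable def termA (r i N e n : ℕ) : PowerSeries ℚ :=
  (-1) ^ n * X ^ (r * n ^ 2 + tri n + e * r * n + (r - i) * n) * poch n e *
    ipoch (N + r * n) (n + e + 1)

/-- The negative half of the terms in the expansion of `weightedGordon`. -/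
noncomputable def termB (r i N e n : ℕ) : PowerSeries ℚ :=
  (-1) ^ n * X ^ (r * n ^ 2 + r * n + tri n + e * r * n + (n + 1 + e) * i) * poch n e *
    ipoch (N + r * n + i) (n + e + 1)

theorem termA_zero (r i N e : ℕ) : termA r i N e 0 = poch 0 e * ipoch N (e + 1) := by
  simp [termA, tri_zero]

theorem termA_eq_termB (r N e n : ℕ) : termA r 0 N e n = termB r 0 N e n := by
  simp only [termA, termB, Nat.sub_zero, add_zero, mul_zero]
  congr 3
  ring

/-- The powers of q differ by `X ^ (n + 1)`; the factor `1 - X ^ (n + 1)` extends `poch (n + 1) e`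
downwards to `poch n (e + 1)`. -/
theorem termA_sub {r i : ℕ} (hi : i < r) (N e n : ℕ) :
    termA r (i + 1) N e (n + 1) - termA r i N e (n + 1) =
      -(X ^ (i * (e + 1)) * termB r (r - i) (N + i) (e + 1) n) := by
  obtain ⟨d, rfl⟩ : ∃ d, r = i + 1 + d := ⟨r - i - 1, by omega⟩
  rw [termA, termA, termB, tri_succ, poch_succ', show i + 1 + d - (i + 1) = d by omega,
    show i + 1 + d - i = d + 1 by omega,
    show N + i + (i + 1 + d) * n + (d + 1) = N + (i + 1 + d) * (n + 1) by ring,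
    show n + (e + 1) + 1 = n + 1 + e + 1 by ring]
  ring

/-- Here `ipoch_telescope` supplies the factor `1 - X ^ (n + e + 1)`, which extends `poch n e`
upwards. -/
theorem termB_sub {r i : ℕ} (hi : i < r) (N e n : ℕ) :
    termB r (i + 1) N e n - termB r i N e n =
      -(X ^ (i * (e + 1)) * termA r (r - i) (N + i) (e + 1) n) := by
  have h := ipoch_telescope (N + r * n + i) (n + e + 1)
  rw [termA, termB, termB, poch_succ n e, show r - (r - i) = i by omega,
    show N + i + r * n = N + r * n + i by ring, show n + (e + 1) + 1 = n + e + 1 + 1 by ring,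
    show N + r * n + (i + 1) = N + r * n + i + 1 by ring]
  linear_combination (-1) ^ n *
    X ^ (r * n ^ 2 + r * n + tri n + e * r * n + (n + 1 + e) * i) * poch n e * h

/-- The truncation of the expansion of `weightedGordon`. -/
noncomputable def expansion (r D i N e : ℕ) : PowerSeries ℚ :=
  ∑ n ∈ Finset.range D, (termA r i N e n - termB r i N e n)

theorem expansion_zero (r D N e : ℕ) : expansion r D 0 N e = 0 :=
  Finset.sum_eq_zero fun n _ => by rw [termA_eq_termB, sub_self]

/-- Differences in `i` exchange the two halves. The term `termA` at `n = 0` does not depend on `i`,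
so that half loses one index, which leaves the boundary `termB` at `D`. -/
theorem expansion_succ {r i : ℕ} (hi : i < r) (D N e : ℕ) :
    expansion r (D + 1) (i + 1) N e - expansion r (D + 1) i N e =
      X ^ (i * (e + 1)) * (expansion r (D + 1) (r - i) (N + i) (e + 1) +
        termB r (r - i) (N + i) (e + 1) D) := by
  have hA : ∑ n ∈ Finset.range (D + 1), termA r (i + 1) N e n -
      ∑ n ∈ Finset.range (D + 1), termA r i N e n =
      -(X ^ (i * (e + 1)) * ∑ n ∈ Finset.range D, termB r (r - i) (N + i) (e + 1) n) := by
    rw [← Finset.sum_sub_distrib, Finset.sum_range_succ', termA_zero, termA_zero, sub_self,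
      add_zero, Finset.mul_sum, ← Finset.sum_neg_distrib]
    exact Finset.sum_congr rfl fun n _ => termA_sub hi N e n
  have hB : ∑ n ∈ Finset.range (D + 1), termB r (i + 1) N e n -
      ∑ n ∈ Finset.range (D + 1), termB r i N e n =
      -(X ^ (i * (e + 1)) * ∑ n ∈ Finset.range (D + 1), termA r (r - i) (N + i) (e + 1) n) := by
    rw [← Finset.sum_sub_distrib, Finset.mul_sum, ← Finset.sum_neg_distrib]
    exact Finset.sum_congr rfl fun n _ => termB_sub hi N e n
  simp only [expansion, Finset.sum_sub_distrib]
  rw [Finset.sum_range_succ (fun n => termB r (r - i) (N + i) (e + 1) n) D]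
  linear_combination hA - hB

theorem X_pow_dvd_termA {r i e n D : ℕ} (N : ℕ) (hr : 0 < r) (hn : 0 < n) (he : D ≤ e) :
    X ^ D ∣ termA r i N e n := by
  have : D ≤ r * n ^ 2 + tri n + e * r * n + (r - i) * n := by
    have h1 : e * 1 ≤ e * (r * n) := Nat.mul_le_mul_left e (Nat.mul_pos hr hn)
    have h2 : e * r * n = e * (r * n) := mul_assoc _ _ _
    omega
  rw [termA, mul_assoc, mul_assoc, mul_left_comm]
  exact dvd_mul_of_dvd_left (pow_dvd_pow X this) _

theorem X_pow_dvd_termB {r i e n D : ℕ} (N : ℕ) (hi : 0 < i) (hD : D ≤ n + 1 + e) :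
    X ^ D ∣ termB r i N e n := by
  have : D ≤ r * n ^ 2 + r * n + tri n + e * r * n + (n + 1 + e) * i := by
    have := Nat.le_mul_of_pos_right (n + 1 + e) hi
    omega
  rw [termB, mul_assoc, mul_assoc, mul_left_comm]
  exact dvd_mul_of_dvd_left (pow_dvd_pow X this) _

theorem expansion_of_le {r i D e : ℕ} (N : ℕ) (hr : 0 < r) (hi : 0 < i) (he : D + 1 ≤ e) :
    X ^ (D + 1) ∣ poch 0 N - expansion r (D + 1) i N e := by
  have h1 : X ^ (D + 1) ∣ expansion r (D + 1) i N e - termA r i N e 0 := by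
    rw [expansion, Finset.sum_range_succ', add_sub_assoc]
    refine dvd_add (Finset.dvd_sum fun n _ => dvd_sub (X_pow_dvd_termA N hr n.succ_pos he)
      (X_pow_dvd_termB N hi (by omega))) ?_
    rw [sub_sub_cancel_left]
    exact (X_pow_dvd_termB N hi (by omega)).neg_right
  -- `termA` at 0 equals `poch 0 N` divided by `poch e (N + 1)`, and the latter is 1 modulo `X ^ (e
  -- + 1)`.
  have h2 : X ^ (D + 1) ∣ poch 0 N - termA r i N e 0 := by
    have h3 : poch 0 N - termA r i N e 0 =
        ipoch N (e + 1) * poch 0 e * (poch e (N + 1) - 1) := by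
      have h4 := poch_add 0 N (e + 1)
      have h5 := poch_add 0 e (N + 1)
      rw [show e + (N + 1) = N + (e + 1) by ring, h4] at h5
      simp only [zero_add] at h5
      rw [termA_zero]
      linear_combination ipoch N (e + 1) * h5 - poch 0 N * poch_mul_ipoch N (e + 1)
    rw [h3]
    exact dvd_mul_of_dvd_right
      ((pow_dvd_pow X (by omega)).trans (X_pow_dvd_poch_sub_one e (N + 1))) _
  rw [show poch 0 N - expansion r (D + 1) i N e = (poch 0 N - termA r i N e 0) -
    (expansion r (D + 1) i N e - termA r i N e 0) by ring]
  exact dvd_sub h2 h1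

/-- The truncation of the sum over the Gordon partitions in which a partition with `m` parts has
weight `q^(em) (1 - q) ⋯ (1 - q^(N+m))`. -/
noncomputable def weightedGordon (r D i N e : ℕ) : PowerSeries ℚ :=
  ∑ m ∈ Finset.range D, X ^ (e * m) * poch 0 (N + m) * gordonSeries r i m

/-- The difference counts partitions with exactly `i` ones; deleting these and lowering the `m`
other parts turns the weight `X ^ (e * (m + i))` into `X ^ (i * (e + 1)) * X ^ ((e + 1) * m)`. -/
theorem weightedGordon_succ {r i : ℕ} (hi : i < r) (D N e : ℕ) :
    X ^ D ∣ weightedGordon r D (i + 1) N e - weightedGordon r D i N e -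
      X ^ (i * (e + 1)) * weightedGordon r D (r - i) (N + i) (e + 1) := by
  set f : ℕ → PowerSeries ℚ := fun m => X ^ (e * m) * poch 0 (N + m) * gordonSeries r (i + 1) m -
    X ^ (e * m) * poch 0 (N + m) * gordonSeries r i m with hf
  have h1 : weightedGordon r D (i + 1) N e - weightedGordon r D i N e =
      ∑ m ∈ Finset.range D, f m := by
    rw [weightedGordon, weightedGordon, ← Finset.sum_sub_distrib]
  have h2 : X ^ (i * (e + 1)) * weightedGordon r D (r - i) (N + i) (e + 1) =
      ∑ m ∈ Finset.range D, f (i + m) := by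
    rw [weightedGordon, Finset.mul_sum]
    refine Finset.sum_congr rfl fun m _ => ?_
    simp only [hf]
    rw [add_comm i m, gordonSeries_succ_add m hi, show N + (m + i) = N + i + m by ring]
    ring
  have h3 : ∑ m ∈ Finset.range i, f m = 0 := by
    refine Finset.sum_eq_zero fun m hm => ?_
    simp only [hf]
    rw [gordonSeries_succ_of_lt (Finset.mem_range.1 hm), sub_self]
  -- The shifted sum runs up to `D + i`; its excess terms have at least `D` parts, hence are
  -- divisible by `X ^ D`.
  have h4 := Finset.sum_range_add f D i
  rw [add_comm D i, Finset.sum_range_add, h3, zero_add] at h4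
  rw [h1, h2, h4, sub_add_cancel_left]
  refine (Finset.dvd_sum fun k _ => ?_).neg_right
  simp only [hf]
  refine dvd_sub ?_ ?_ <;>
  exact dvd_mul_of_dvd_right ((pow_dvd_pow X (by omega)).trans (X_pow_dvd_gordonSeries _ _ _)) _

theorem weightedGordon_of_le {r i D e : ℕ} (N : ℕ) (hr : 0 < r) (hi : 0 < i) (he : D + 1 ≤ e) :
    X ^ (D + 1) ∣ weightedGordon r (D + 1) i N e - poch 0 N := by
  rw [weightedGordon, Finset.sum_range_succ', gordonSeries_zero_right hr hi]
  simp only [mul_zero, pow_zero, one_mul, mul_one, add_zero, add_sub_cancel_right]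
  refine Finset.dvd_sum fun m _ => ?_
  rw [mul_assoc]
  exact dvd_mul_of_dvd_left
    (pow_dvd_pow X (he.trans (Nat.le_mul_of_pos_right e m.succ_pos))) _

/-- The common recursion lowers `i` or raises `e`. So the induction descends in `e` from `D + 1`,
where both sides are `poch 0 N` for `i > 0`, with an inner induction on `i` from 0, where both
vanish. -/
theorem weightedGordon_expansion {r : ℕ} (hr : 0 < r) (D k : ℕ) :
    ∀ e, D + 1 ≤ e + k → ∀ i ≤ r, ∀ N,
      X ^ (D + 1) ∣ weightedGordon r (D + 1) i N e - expansion r (D + 1) i N e := by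
  have hzero : ∀ N e, weightedGordon r (D + 1) 0 N e - expansion r (D + 1) 0 N e = 0 := by
    intro N e
    rw [expansion_zero, weightedGordon, sub_zero]
    exact Finset.sum_eq_zero fun m _ => by rw [gordonSeries_zero_left, mul_zero]
  induction k with
  | zero =>
    intro e he i _ N
    rcases Nat.eq_zero_or_pos i with rfl | h0
    · rw [hzero]
      exact dvd_zero _
    · rw [← sub_add_sub_cancel _ (poch 0 N)]
      exact dvd_add (weightedGordon_of_le N hr h0 he) (expansion_of_le N hr h0 he)
  | succ k ih =>
    intro e he i hi N
    induction i with
    | zero =>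
      rw [hzero]
      exact dvd_zero _
    | succ i ihi =>
      have h1 := ihi (by omega)
      have h2 := weightedGordon_succ (r := r) (i := i) (by omega) (D + 1) N e
      have h3 := expansion_succ (i := i) (r := r) (by omega) D N e
      have h4 := ih (e + 1) (by omega) (r - i) (by omega) (N + i)
      have h5 : X ^ (D + 1) ∣ termB r (r - i) (N + i) (e + 1) D :=
        X_pow_dvd_termB _ (by omega) (by omega)
      have h6 : weightedGordon r (D + 1) (i + 1) N e - expansion r (D + 1) (i + 1) N e =
          (weightedGordon r (D + 1) (i + 1) N e - weightedGordon r (D + 1) i N e -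
            X ^ (i * (e + 1)) * weightedGordon r (D + 1) (r - i) (N + i) (e + 1)) +
          (weightedGordon r (D + 1) i N e - expansion r (D + 1) i N e) +
          X ^ (i * (e + 1)) * ((weightedGordon r (D + 1) (r - i) (N + i) (e + 1) -
            expansion r (D + 1) (r - i) (N + i) (e + 1)) -
            termB r (r - i) (N + i) (e + 1) D) := by
        linear_combination -h3
      rw [h6]
      exact dvd_add (dvd_add h2 h1) (dvd_mul_of_dvd_right (dvd_sub h4 h5) _)

/-! ### The telescoping sum -/

/-- The terms of the telescoping sum which evaluates `sum_expansion`. -/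
noncomputable def teleTerm (r n : ℕ) : PowerSeries ℚ :=
  (-1) ^ n * X ^ (r * n ^ 2 + r * n + tri n) * ipoch (r * (n + 1)) n

theorem sum_termA (p n : ℕ) :
    ∑ j ∈ Finset.range (p + 1), X ^ j * termA (p + 1) (p + 1 - j) p 1 n =
      (-1) ^ n * X ^ ((p + 1) * n ^ 2 + (p + 1) * n + tri n) *
        ipoch ((p + 1) * (n + 1)) (n + 1) := by
  have h1 : ∀ j ∈ Finset.range (p + 1), X ^ j * termA (p + 1) (p + 1 - j) p 1 n =
      (X ^ (n + 1)) ^ j * ((-1) ^ n * X ^ ((p + 1) * n ^ 2 + (p + 1) * n + tri n) *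
        (1 - X ^ (n + 1)) * ipoch (p + (p + 1) * n) (n + 2)) := by
    intro j hj
    have := Finset.mem_range.1 hj
    rw [termA, poch_succ, poch_zero, show p + 1 - (p + 1 - j) = j by omega]
    ring
  rw [Finset.sum_congr rfl h1, ← Finset.sum_mul]
  have h2 := mul_neg_geom_sum (X ^ (n + 1) : PowerSeries ℚ) (p + 1)
  have h3 := ipoch_succ' (p + (p + 1) * n) (n + 1)
  rw [show p + (p + 1) * n + 1 = (p + 1) * (n + 1) by ring] at h3
  rw [← h3]
  linear_combination (-1) ^ n * X ^ ((p + 1) * n ^ 2 + (p + 1) * n + tri n) *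
    ipoch (p + (p + 1) * n) (n + 2) * h2

theorem sum_termB (p n : ℕ) :
    ∑ j ∈ Finset.range (p + 1), X ^ j * termB (p + 1) (p + 1 - j) p 1 n =
      (-1) ^ n * X ^ ((p + 1) * n ^ 2 + 2 * (p + 1) * n + tri n + n + 1 + (p + 1)) *
        (ipoch ((p + 1) * (n + 1)) (n + 1) -
          X ^ ((n + 1) * (p + 1)) * ipoch ((p + 1) * (n + 2)) (n + 1)) := by
  -- In the reversed order the summands are consecutive differences of `v`, by `ipoch_telescope`.
  rw [← Finset.sum_range_reflect]
  set v : ℕ → PowerSeries ℚ := fun i =>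
    X ^ ((n + 1) * i) * ipoch ((p + 1) * (n + 1) + i) (n + 1) with hv
  have h1 : ∀ i ∈ Finset.range (p + 1),
      X ^ (p + 1 - 1 - i) * termB (p + 1) (p + 1 - (p + 1 - 1 - i)) p 1 n =
      (-1) ^ n * X ^ ((p + 1) * n ^ 2 + 2 * (p + 1) * n + tri n + n + 1 + (p + 1)) *
        (v i - v (i + 1)) := by
    intro i hi
    obtain ⟨d, rfl⟩ : ∃ d, p = i + d := ⟨p - i, by have := Finset.mem_range.1 hi; omega⟩
    have h := ipoch_telescope ((i + d + 1) * (n + 1) + i) (n + 1)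
    simp only [hv]
    rw [termB, poch_succ, poch_zero, show i + d + 1 - 1 - i = d by omega,
      show i + d + 1 - d = i + 1 by omega,
      show i + d + (i + d + 1) * n + (i + 1) = (i + d + 1) * (n + 1) + i by ring,
      ← add_assoc ((i + d + 1) * (n + 1)) i 1]
    linear_combination (-1) ^ n * X ^ ((i + d + 1) * n ^ 2 + 2 * (i + d + 1) * n + tri n + n + 1 +
      (i + d + 1)) * X ^ ((n + 1) * i) * h
  rw [Finset.sum_congr rfl h1, ← Finset.mul_sum, Finset.sum_range_sub']
  simp only [hv, mul_zero, pow_zero, one_mul, add_zero]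
  rw [show (p + 1) * (n + 1) + (p + 1) = (p + 1) * (n + 2) by ring]

/-- Index `n` contributes `teleTerm n - teleTerm (n + 1)`: `sum_termA` and the first piece of
`sum_termB` merge by `ipoch_succ`, and the second piece is the next term. -/
theorem sum_expansion (p D : ℕ) :
    ∑ j ∈ Finset.range (p + 1), X ^ j * expansion (p + 1) D (p + 1 - j) p 1 =
      1 - teleTerm (p + 1) D := by
  have h0 : teleTerm (p + 1) 0 = 1 := by
    rw [teleTerm, eq_comm, tri_zero]
    simp [ipoch]
  rw [← h0, ← Finset.sum_range_sub']
  simp only [expansion, Finset.mul_sum]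
  rw [Finset.sum_comm]
  refine Finset.sum_congr rfl fun n _ => ?_
  simp only [mul_sub, Finset.sum_sub_distrib]
  rw [sum_termA, sum_termB, teleTerm, teleTerm, tri_succ,
    ← ipoch_succ ((p + 1) * (n + 1)) n]
  ring

/-- The Gordon partitions, each with weight `(1 - q) ⋯ (1 - q^(r-1+m))`, where `m` is the number of
its parts different from `1`, sum up to `1`. -/
theorem sum_gordon_big (p D : ℕ) :
    X ^ (D + 1) ∣ ∑ m ∈ Finset.range (D + 1),
      gf Multiset.sum {s | s ∈ gordon (p + 1) ∧ s.card - s.count 1 = m} * poch 0 (p + m) - 1 := by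
  have h1 : ∑ m ∈ Finset.range (D + 1),
      gf Multiset.sum {s | s ∈ gordon (p + 1) ∧ s.card - s.count 1 = m} * poch 0 (p + m) =
      ∑ j ∈ Finset.range (p + 1), X ^ j * weightedGordon (p + 1) (D + 1) (p + 1 - j) p 1 := by
    simp only [weightedGordon, Finset.mul_sum, gf_gordon_big, Finset.sum_mul]
    rw [Finset.sum_comm]
    refine Finset.sum_congr rfl fun j _ => Finset.sum_congr rfl fun m _ => ?_
    ring
  have h2 : X ^ (D + 1) ∣ teleTerm (p + 1) (D + 1) := by
    rw [teleTerm, mul_assoc, mul_left_comm]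
    refine dvd_mul_of_dvd_left (pow_dvd_pow X ?_) _
    have := Nat.le_mul_of_pos_left (D + 1) p.succ_pos
    simp only [Nat.succ_eq_add_one] at this
    omega
  have h3 : X ^ (D + 1) ∣
      ∑ j ∈ Finset.range (p + 1), X ^ j * weightedGordon (p + 1) (D + 1) (p + 1 - j) p 1 -
      ∑ j ∈ Finset.range (p + 1), X ^ j * expansion (p + 1) (D + 1) (p + 1 - j) p 1 := by
    rw [← Finset.sum_sub_distrib]
    refine Finset.dvd_sum fun j _ => ?_
    rw [← mul_sub]
    exact dvd_mul_of_dvd_right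
      (weightedGordon_expansion p.succ_pos D (D + 1) 1 (by omega) _ (by omega) p) _
  rw [sum_expansion] at h3
  rw [h1]
  have h4 := dvd_sub h3 h2
  rwa [show ∀ a b : PowerSeries ℚ, a - (1 - b) - b = a - 1 from fun a b => by ring] at h4

end PartitionSeries

/-! ### From colored partitions to triples of partitions -/

namespace PartitionSeries

open PowerSeries ColoredPartition

/-- The black, red and green subpartitions. -/
def toTriple {n : ℕ} (l : ColoredPartition n) : (Multiset ℕ × Multiset ℕ) × Multiset ℕ :=
  ((l.sub .black, l.sub .red), l.sub .green)

/-- The total size of a triple of partitions. -/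
def tripleSum (x : (Multiset ℕ × Multiset ℕ) × Multiset ℕ) : ℕ := pairSum x.1 + x.2.sum

theorem parts_eq_add {α : Type*} (s : Multiset (α × PartColor)) :
    ((s.filter fun p => p.2 = .black).map Prod.fst).map (·, PartColor.black) +
      ((s.filter fun p => p.2 = .red).map Prod.fst).map (·, PartColor.red) +
      ((s.filter fun p => p.2 = .green).map Prod.fst).map (·, PartColor.green) = s := by
  induction s using Multiset.induction_on with
  | empty => simp
  | cons a s ih =>
    obtain ⟨a, c⟩ := a
    conv_rhs => rw [← ih]
    cases c <;> simp

theorem sub_mem_partitions {n : ℕ} (l : ColoredPartition n) (c : PartColor) :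
    l.sub c ∈ partitions := by
  intro h
  obtain ⟨p, hp, h0⟩ := Multiset.mem_map.1 h
  exact (l.parts_pos p (Multiset.mem_filter.1 hp).1).ne' h0

theorem tripleSum_toTriple {n : ℕ} (l : ColoredPartition n) : tripleSum (toTriple l) = n := by
  conv_rhs => rw [← l.parts_sum, ← parts_eq_add l.parts]
  simp [tripleSum, pairSum, toTriple, ColoredPartition.sub]

theorem toTriple_injective (n : ℕ) : Function.Injective (toTriple (n := n)) := by
  intro l l' h
  simp only [toTriple, ColoredPartition.sub, Prod.mk.injEq] at h
  apply ColoredPartition.ext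
  rw [← parts_eq_add l.parts, ← parts_eq_add l'.parts, h.1.1, h.1.2, h.2]

theorem filter_map_color (s : Multiset ℕ) (c c' : PartColor) :
    ((s.map (·, c)).filter fun p => p.2 = c').map Prod.fst = if c = c' then s else 0 := by
  rw [Multiset.filter_map]
  split_ifs with h <;> simp [h]

/-- The triples of partitions. -/
def triples : Set ((Multiset ℕ × Multiset ℕ) × Multiset ℕ) :=
  (partitions ×ˢ partitions) ×ˢ partitions

theorem exists_toTriple {n : ℕ} {x : (Multiset ℕ × Multiset ℕ) × Multiset ℕ} (hx : x ∈ triples)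
    (hn : tripleSum x = n) : ∃ l : ColoredPartition n, toTriple l = x := by
  obtain ⟨⟨b, d⟩, g⟩ := x
  obtain ⟨⟨hb, hd⟩, hg⟩ := hx
  have hpos : ∀ {s : Multiset ℕ}, s ∈ partitions → ∀ a ∈ s, 0 < a := fun hs a ha =>
    Nat.pos_of_ne_zero fun h => hs (h ▸ ha)
  refine ⟨⟨b.map (·, .black) + d.map (·, .red) + g.map (·, .green), ?_, ?_⟩, ?_⟩
  · intro p hp
    simp only [Multiset.mem_add, Multiset.mem_map] at hp
    rcases hp with (⟨a, ha, rfl⟩ | ⟨a, ha, rfl⟩) | ⟨a, ha, rfl⟩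
    exacts [hpos hb a ha, hpos hd a ha, hpos hg a ha]
  · rw [← hn]
    simp [tripleSum, pairSum]
  · simp only [toTriple, ColoredPartition.sub, Multiset.filter_add, Multiset.map_add,
      filter_map_color]
    simp

theorem finFib_triples : FinFib tripleSum triples :=
  (finFib_partitions.prod finFib_partitions).prod finFib_partitions

theorem mk_ncard {P : ∀ {n : ℕ}, ColoredPartition n → Prop}
    {Q : (Multiset ℕ × Multiset ℕ) × Multiset ℕ → Prop}
    (hPQ : ∀ {n : ℕ} (l : ColoredPartition n), P l ↔ Q (toTriple l)) :
    (PowerSeries.mk fun n => (({l : ColoredPartition n | P l}.ncard : ℕ) : ℚ)) =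
      gf tripleSum {x | x ∈ triples ∧ Q x} := by
  ext n
  rw [coeff_gf, PowerSeries.coeff_mk, ← Set.ncard_image_of_injective _ (toTriple_injective n)]
  congr 2
  ext x
  constructor
  · rintro ⟨l, hl, rfl⟩
    exact ⟨⟨⟨⟨sub_mem_partitions l _, sub_mem_partitions l _⟩, sub_mem_partitions l _⟩,
      (hPQ l).1 hl⟩, tripleSum_toTriple l⟩
  · rintro ⟨⟨hx, hQ⟩, hn⟩
    obtain ⟨l, rfl⟩ := exists_toTriple hx hn
    exact ⟨l, (hPQ l).2 hQ, rfl⟩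

theorem nthSmallest_getElem? {s : Multiset ℕ} {j : ℕ} (hj : 0 < j) (hs : j ≤ s.card) :
    (s.sort (· ≤ ·))[j - 1]? = some (nthSmallest s j) := by
  have hlen : (s.sort (· ≤ ·)).length = s.card := Multiset.length_sort _
  rw [nthSmallest, List.getD_eq_getElem?_getD, List.getElem?_eq_getElem (by omega)]
  rfl

theorem nthSmallest_le_iff {s : Multiset ℕ} {j : ℕ} (hj : 0 < j) (hs : j ≤ s.card) {p : ℕ → Prop}
    [DecidablePred p] (hp : ∀ x y, x ≤ y → p y → p x) :
    p (nthSmallest s j) ↔ j - 1 < s.countP p := by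
  have h := getElem?_countP (p := p) ((Multiset.pairwise_sort s (· ≤ ·)).imp fun h => hp _ _ h)
    (nthSmallest_getElem? hj hs)
  rw [h, ← Multiset.coe_countP, Multiset.sort_eq]

theorem nthSmallest_one_mem {s : Multiset ℕ} (hs : s ≠ 0) : nthSmallest s 1 ∈ s := by
  rw [← Multiset.mem_sort (· ≤ ·)]
  exact List.mem_of_getElem? (nthSmallest_getElem? one_pos (Multiset.card_pos.2 hs))

theorem nthSmallest_one_le {s : Multiset ℕ} {x : ℕ} (hx : x ∈ s) : nthSmallest s 1 ≤ x := by
  rw [nthSmallest_le_iff one_pos (Multiset.card_pos.2 fun h => by simp [h] at hx)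
    (p := (· ≤ x)) fun a b h h' => h.trans h', Nat.sub_self]
  exact Multiset.countP_pos_of_mem hx le_rfl

theorem good_iff {s : ℕ} {b d : Multiset ℕ} (hb : b ∈ partitions) (hb0 : b ≠ 0) :
    Good s b d ↔ d.card < nthSmallest b 1 ∨ (nthSmallest b 1 ≤ d.card ∧
      s ≤ nthSmallest b 1 + nthSmallest d (nthSmallest b 1)) := by
  set k := nthSmallest b 1 with hk
  have hmem : k ∈ b := nthSmallest_one_mem hb0
  have hk0 : 0 < k := Nat.pos_of_ne_zero fun h => hb (h ▸ hmem)
  have h1 : Good s b d ↔ d.countP (fun x => x + k < s) < k := by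
    constructor
    · intro h
      exact h k hmem fun x hx => nthSmallest_one_le hx
    · intro h k' hk' hle
      obtain rfl : k' = k := le_antisymm (hle k hmem) (nthSmallest_one_le hk')
      exact h
  rw [h1]
  have hcard : d.countP (fun x => x + k < s) ≤ d.card := Multiset.countP_le_card _ _
  rcases Nat.lt_or_ge d.card k with h | h
  · simp only [h, true_or, iff_true]
    omega
  · have := nthSmallest_le_iff hk0 h (p := fun x => x + k < s) (fun x y hxy hy => by omega)
    omega

theorem mem_colors {n : ℕ} (l : ColoredPartition n) (c : PartColor) :
    c ∈ l.colors ↔ l.sub c ≠ 0 := by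
  simp [ColoredPartition.colors, ColoredPartition.sub, Multiset.eq_zero_iff_forall_notMem]

theorem colors_cases : ∀ S : Finset PartColor,
    ((S = ∅ ∨ S.card = 1 ∨ (S.card = 2 ∧ .green ∈ S)) ↔ (.black ∉ S ∨ .red ∉ S)) ∧
    (S = {.black, .red} ↔ .black ∈ S ∧ .red ∈ S ∧ .green ∉ S) ∧
    (S = {.black, .red, .green} ↔ .black ∈ S ∧ .red ∈ S ∧ .green ∈ S) := by
  decide

/-- `Good` is automatic without black or red parts. With both, the green inequality says that `k +
i_k` is at least `r` plus the number of green parts other than 1, which includes `r ≤ k + i_k`;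
without green parts the two bounds coincide. -/
theorem inF_iff {n r : ℕ} (hr : 2 ≤ r) (l : ColoredPartition n) :
    l.InF r ↔ (l.sub .green ∈ gordon r ∧
      Good (r + ((l.sub .green).card - (l.sub .green).count 1)) (l.sub .black) (l.sub .red)) := by
  obtain ⟨c1, c2, c3⟩ := colors_cases l.colors
  have h0 : l.parts = 0 ↔ l.colors = ∅ := by simp [ColoredPartition.colors]
  have hG : IsGordon r r (l.sub .green) ↔ l.sub .green ∈ gordon r := by
    rw [isGordon_iff hr (sub_mem_partitions l _)]
    exact ⟨fun h => ⟨sub_mem_partitions l _, h⟩, fun h => h.2⟩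
  rw [InF, h0, c1, c2, c3, hG]
  simp only [mem_colors, not_not, ColoredPartition.len, ColoredPartition.ik, ColoredPartition.k]
  refine and_congr_right fun _ => ?_
  have hb := sub_mem_partitions l .black
  have hd := sub_mem_partitions l .red
  generalize l.sub .black = b at *
  generalize l.sub .red = d at *
  generalize l.sub .green = g at *
  by_cases hb0 : b = 0
  · subst hb0
    simp [Good]
  by_cases hd0 : d = 0
  · subst hd0
    have : Good (r + (g.card - g.count 1)) b 0 := fun k hk _ => by
      rw [Multiset.countP_zero]
      exact Nat.pos_of_ne_zero fun h => hb (h ▸ hk)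
    simp [this]
  rw [good_iff hb hb0]
  have hg : g.count 1 ≤ g.card := Multiset.count_le_card 1 g
  by_cases hg0 : g = 0
  · subst hg0
    simp [hb0, hd0]
  · simp only [ne_eq, hb0, hd0, hg0, not_false_eq_true, or_self, false_or,
      and_false, false_and, true_and]
    omega

theorem eq_of_forall_X_pow_dvd {f g : PowerSeries ℚ} (h : ∀ D : ℕ, X ^ (D + 1) ∣ f - g) :
    f = g := by
  ext n
  have := X_pow_dvd_iff.1 (h n) n (Nat.lt_succ_self n)
  rwa [map_sub, sub_eq_zero] at this

/-- Sorting by the number `m` of green parts other than 1 makes the pair and the green partition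
independent; `gf_goodPairs` then produces exactly the weights summed in `sum_gordon_big`. -/
theorem mk_F (p : ℕ) :
    (1 - X) * (PowerSeries.mk fun n => (F (p + 2) n : ℚ)) = H ^ 2 := by
  have hF : (PowerSeries.mk fun n => (F (p + 2) n : ℚ)) = gf tripleSum {x | x ∈ triples ∧
      (x.2 ∈ gordon (p + 2) ∧ Good (p + 2 + (x.2.card - x.2.count 1)) x.1.1 x.1.2)} :=
    mk_ncard fun l => inF_iff (by omega) l
  rw [hF]
  refine eq_of_forall_X_pow_dvd fun D => ?_
  have h1 := gf_trunc (finFib_triples.mono (S' := {x | x ∈ triples ∧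
      (x.2 ∈ gordon (p + 2) ∧ Good (p + 2 + (x.2.card - x.2.count 1)) x.1.1 x.1.2)})
    fun _ h => h.1) (fun x => x.2.card - x.2.count 1) (fun x hx => by
      have := card_le_sum hx.1.2
      simp only [tripleSum]
      omega) (D + 1)
  have h2 : ∀ m, gf tripleSum {x | x ∈ {x | x ∈ triples ∧ (x.2 ∈ gordon (p + 2) ∧
      Good (p + 2 + (x.2.card - x.2.count 1)) x.1.1 x.1.2)} ∧ x.2.card - x.2.count 1 = m} =
      gf pairSum (goodPairs (p + m + 2)) *
        gf Multiset.sum {s | s ∈ gordon (p + 2) ∧ s.card - s.count 1 = m} := by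
    intro m
    rw [← gf_prod (finFib_goodPairs _) ((finFib_gordon _).mono fun _ h => h.1)]
    refine congrArg (gf tripleSum) ?_
    ext ⟨⟨b, d⟩, g⟩
    simp only [triples, goodPairs, Set.mem_ofPred_eq, Set.mem_prod]
    constructor
    · rintro ⟨⟨⟨⟨hb, hd⟩, hg⟩, hgo, hgood⟩, rfl⟩
      rw [add_right_comm] at hgood
      exact ⟨⟨⟨hb, hd⟩, hgood⟩, hgo, rfl⟩
    · rintro ⟨⟨⟨hb, hd⟩, hgood⟩, hgo, rfl⟩
      rw [add_right_comm] at hgood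
      exact ⟨⟨⟨⟨hb, hd⟩, hgo.1⟩, hgo, hgood⟩, rfl⟩
  have h3 := sum_gordon_big (p + 1) D
  rw [Finset.sum_congr rfl fun m _ => h2 m] at h1
  have h4 : (1 - X) * ∑ m ∈ Finset.range (D + 1), gf pairSum (goodPairs (p + m + 2)) *
        gf Multiset.sum {s | s ∈ gordon (p + 2) ∧ s.card - s.count 1 = m} =
      H ^ 2 * ∑ m ∈ Finset.range (D + 1), gf Multiset.sum
        {s | s ∈ gordon (p + 1 + 1) ∧ s.card - s.count 1 = m} * poch 0 (p + 1 + m) := by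
    rw [Finset.mul_sum, Finset.mul_sum]
    refine Finset.sum_congr rfl fun m _ => ?_
    rw [← mul_assoc, gf_goodPairs, show p + m + 1 = p + 1 + m by ring]
    ring
  have h5 := dvd_add (h1.mul_left (1 - X)) (h3.mul_left (H ^ 2))
  rw [mul_sub, mul_sub, h4, mul_one, sub_add_sub_cancel] at h5
  exact h5

/-- Black and red are arbitrary, giving `H ^ 2`; green consists of ones only, giving the geometric
series. -/
theorem mk_numOneThreeRestTwo :
    (1 - X) * (PowerSeries.mk fun n => (numOneThreeRestTwo n : ℚ)) = H ^ 2 := by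
  have hQ : (PowerSeries.mk fun n => (numOneThreeRestTwo n : ℚ)) =
      gf tripleSum {x | x ∈ triples ∧ ∀ y ∈ x.2, y = 1} := by
    refine mk_ncard (P := fun l => ∀ p ∈ l.parts, p.1 ≠ 1 → p.2 = .black ∨ p.2 = .red)
      (Q := fun x => ∀ y ∈ x.2, y = 1) fun l => ?_
    simp only [toTriple, ColoredPartition.sub, Multiset.mem_map, Multiset.mem_filter]
    constructor
    · rintro h y ⟨⟨a, c⟩, ⟨hp, rfl⟩, rfl⟩
      by_contra hy
      simpa using h _ hp hy
    · rintro h ⟨a, c⟩ hp ha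
      cases c
      · exact Or.inl rfl
      · exact Or.inr rfl
      · exact absurd (h a ⟨_, ⟨hp, rfl⟩, rfl⟩) ha
  have hset : {x : (Multiset ℕ × Multiset ℕ) × Multiset ℕ | x ∈ triples ∧ ∀ y ∈ x.2, y = 1} =
      (partitions ×ˢ partitions) ×ˢ {s | s ∈ partitions ∧ ∀ y ∈ s, y = 1} := by
    ext x
    simp only [triples, Set.mem_ofPred_eq, Set.mem_prod]
    tauto
  have hones : gf Multiset.sum {s | s ∈ partitions ∧ ∀ y ∈ s, y = 1} = PowerSeries.mk 1 := by
    ext n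
    have : {s | s ∈ {s | s ∈ partitions ∧ ∀ y ∈ s, y = 1} ∧ s.sum = n} =
        {Multiset.replicate n 1} := by
      ext s
      simp only [Set.mem_ofPred_eq, Set.mem_singleton_iff]
      constructor
      · rintro ⟨⟨-, h⟩, hn⟩
        rw [Multiset.eq_replicate_card.2 h, Multiset.sum_replicate] at hn
        rw [Multiset.eq_replicate_card.2 h, ← hn]
        simp
      · rintro rfl
        refine ⟨⟨fun h => ?_, fun y hy => Multiset.eq_of_mem_replicate hy⟩, by simp⟩
        exact zero_ne_one (Multiset.eq_of_mem_replicate h)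
    rw [coeff_gf, this]
    simp
  have hprod := gf_prod (finFib_partitions.prod finFib_partitions)
    (finFib_partitions.mono (S' := {s | s ∈ partitions ∧ ∀ y ∈ s, y = 1}) fun _ h => h.1)
  rw [gf_prod finFib_partitions finFib_partitions, gf_partitions, hones] at hprod
  rw [hQ, hset]
  refine (congrArg _ hprod).trans ?_
  linear_combination H ^ 2 * PowerSeries.mk_one_mul_one_sub_eq_one ℚ

end PartitionSeries

theorem theoremB :
    (∀ n r s : ℕ, 2 ≤ r → 2 ≤ s → ColoredPartition.F r n = ColoredPartition.F s n) ∧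
    (∀ n r : ℕ, 2 ≤ r → ColoredPartition.F r n = ColoredPartition.numOneThreeRestTwo n) ∧
    (∀ r : ℕ, 2 ≤ r →
      (PowerSeries.mk fun n => (ColoredPartition.F r n : ℚ)) =
        ColoredPartition.H ^ 2 * (1 - PowerSeries.X)⁻¹) := by
  have hunit : PowerSeries.constantCoeff (1 - PowerSeries.X : PowerSeries ℚ) ≠ 0 := by simp
  have hF : ∀ r : ℕ, 2 ≤ r → (PowerSeries.mk fun n => (ColoredPartition.F r n : ℚ)) =
      ColoredPartition.H ^ 2 * (1 - PowerSeries.X)⁻¹ := by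
    intro r hr
    obtain ⟨p, rfl⟩ : ∃ p, r = p + 2 := ⟨r - 2, by omega⟩
    rw [PowerSeries.eq_mul_inv_iff_mul_eq hunit, mul_comm, PartitionSeries.mk_F]
  have hN : (PowerSeries.mk fun n => (ColoredPartition.numOneThreeRestTwo n : ℚ)) =
      ColoredPartition.H ^ 2 * (1 - PowerSeries.X)⁻¹ := by
    rw [PowerSeries.eq_mul_inv_iff_mul_eq hunit, mul_comm, PartitionSeries.mk_numOneThreeRestTwo]
  have h : ∀ n r : ℕ, 2 ≤ r →
      ColoredPartition.F r n = ColoredPartition.numOneThreeRestTwo n := by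
    intro n r hr
    have := congrArg (PowerSeries.coeff n) ((hF r hr).trans hN.symm)
    rw [PowerSeries.coeff_mk, PowerSeries.coeff_mk] at this
    exact_mod_cast this
  exact ⟨fun n r s hr hs => (h n r hr).trans (h n s hs).symm, h, hF⟩
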